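/- Let $K$ be a field and let $X$ be a Noetherian scheme over $K$. Write $\Omega_X=\Omega_{X/K}$ for the sheaf of Kähler differentials, and, for $m\ge 0$, $\Omega_X^{\otimes m}$ for its $m$-th tensor power over $\mathcal{O}_X$ (so $\Omega_X^{\otimes 0}=\mathcal{O}_X$). For a $K$-endomorphism $f\colon X\to X$ let $df\colon f^{*}\Omega_X\to\Omega_X$ be its differential, locally given by $db\otimes a\mapsto a\,d(f^{\sharp}(b))$, and let $(df)^{\otimes m}\colon f^{*}(\Omega_X^{\otimes m})\to\Omega_X^{\otimes m}$ be its $m$-th tensor power (for $m=0$, the canonical map $f^*\mathcal{O}_X\to\mathcal{O}_X$). For $p\ge 0$ let $$D_m^p(f)\colon H^{p}(X,\Omega_X^{\otimes m})\to H^{p}(X,\Omega_X^{\otimes m})$$ be the $K$-linear map that is the composite of the pull-back $H^{p}(X,\Omega_X^{\otimes m})\to H^{p}(X,f_{*}f^{*}(\Omega_X^{\otimes m}))\to H^{p}(X,f^{*}(\Omega_X^{\otimes m}))$ with the map $H^{p}(X,f^{*}(\Omega_X^{\otimes m}))\to H^{p}(X,\Omega_X^{\otimes m})$ induced by $(df)^{\otimes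 m}$. Here the first arrow is induced by the unit of the adjunction $f^*\dashv f_*$, and the second is the canonical map $H^p(X,f_*\mathcal{G})\to H^p(X,\mathcal{G})$. Then for all $p,m\ge 0$ and all $K$-endomorphisms $f,g$ of $X$, $$D_m^p(g\circ f)=D_m^p(f)\circ D_m^p(g).$$ In particular, $D_m^p(\varphi^{n})=D_m^p(\varphi)^{n}$ for every $K$-endomorphism $\varphi$ of $X$ and every integer $n\ge 0$. -/

import Mathlib

universe u

open CategoryTheory AlgebraicGeometry TopologicalSpace MonoidalCategory

noncomputable section

namespace SchemeForms

/-! ### Sheafification, tensor products and direct images of modules -/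

/-- The associated sheaf of a presheaf of `𝒪_X`-modules. -/
def sheafifyFunctor (X : Scheme.{u}) : X.PresheafOfModules ⥤ X.Modules :=
  PresheafOfModules.sheafification (𝟙 X.ringCatSheaf.obj)

/-- Sheafification is left adjoint to the inclusion of sheaves into presheaves. -/
def sheafifyAdj (X : Scheme.{u}) :
    sheafifyFunctor X ⊣ Scheme.Modules.toPresheafOfModules X :=
  PresheafOfModules.sheafificationAdjunction (𝟙 X.ringCatSheaf.obj)

/-- The presheaf `U ↦ P(U) ⊗_{𝒪_X(U)} Q(U)`. -/
def presheafTensor {X : Scheme.{u}} (P Q : X.PresheafOfModules) : X.PresheafOfModules :=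
  PresheafOfModules.Monoidal.tensorObj (R := X.presheaf) P Q

def presheafTensorMap {X : Scheme.{u}} {P Q P' Q' : X.PresheafOfModules}
    (a : P ⟶ P') (b : Q ⟶ Q') : presheafTensor P Q ⟶ presheafTensor P' Q' :=
  PresheafOfModules.Monoidal.tensorHom (R := X.presheaf) a b

/-- The tensor product `M ⊗_{𝒪_X} N`: the sheaf associated with `U ↦ M(U) ⊗ N(U)`. -/
def tensor {X : Scheme.{u}} (M N : X.Modules) : X.Modules :=
  (sheafifyFunctor X).obj (presheafTensor M.val N.val)

/-- `a ⊗ b : M ⊗ N ⟶ M' ⊗ N'`. -/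
def tensorMap {X : Scheme.{u}} {M N M' N' : X.Modules} (a : M ⟶ M') (b : N ⟶ N') :
    tensor M N ⟶ tensor M' N' :=
  (sheafifyFunctor X).map (presheafTensorMap a.val b.val)

/-- `𝒪_X` as a module over itself. -/
def structureSheaf (X : Scheme.{u}) : X.Modules := SheafOfModules.unit X.ringCatSheaf

/-- The direct image of presheaves of modules (`Scheme.Modules.pushforward` on presheaves). -/
def presheafPushforward {X Y : Scheme.{u}} (f : X ⟶ Y) :
    X.PresheafOfModules ⥤ Y.PresheafOfModules :=
  PresheafOfModules.pushforward f.toRingCatSheafHom.hom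

/-- For a ring homomorphism `A → B` and `B`-modules `M`, `N`, the map `M ⊗_A N → M ⊗_B N`,
`p ⊗ q ↦ p ⊗ q`. -/
def restrictScalarsTensor {A B : CommRingCat.{u}} (φ : A ⟶ B) (M N : ModuleCat.{u} B) :
    (ModuleCat.restrictScalars φ.hom).obj M ⊗ (ModuleCat.restrictScalars φ.hom).obj N ⟶
      (ModuleCat.restrictScalars φ.hom).obj (M ⊗ N) :=
  ModuleCat.MonoidalCategory.tensorLift (R := A)
    (M₁ := (ModuleCat.restrictScalars φ.hom).obj M)
    (M₂ := (ModuleCat.restrictScalars φ.hom).obj N)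
    (M₃ := (ModuleCat.restrictScalars φ.hom).obj (M ⊗ N))
    (fun (p : M) (q : N) ↦ TensorProduct.tmul B p q)
    (fun (p p' : M) (q : N) ↦ TensorProduct.add_tmul p p' q)
    (fun _ (_ : M) (_ : N) ↦ rfl)
    (fun (p : M) (q q' : N) ↦ TensorProduct.tmul_add p q q')
    (fun a (p : M) (q : N) ↦ TensorProduct.tmul_smul (φ.hom a) p q)

/-- The map `P(f⁻¹U) ⊗_{𝒪_Y(U)} Q(f⁻¹U) → P(f⁻¹U) ⊗_{𝒪_X(f⁻¹U)} Q(f⁻¹U)`, `p ⊗ q ↦ p ⊗ q`. -/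
def presheafPushforwardTensor {X Y : Scheme.{u}} (f : X ⟶ Y) (P Q : X.PresheafOfModules) :
    presheafTensor ((presheafPushforward f).obj P) ((presheafPushforward f).obj Q) ⟶
      (presheafPushforward f).obj (presheafTensor P Q) where
  app U := restrictScalarsTensor (f.c.app U)
    (P.obj (.op (f ⁻¹ᵁ U.unop))) (Q.obj (.op (f ⁻¹ᵁ U.unop)))
  naturality {U V} i := ModuleCat.MonoidalCategory.tensor_ext fun m n ↦ by
    rfl

/-- The canonical map `f_* M ⊗ f_* N ⟶ f_* (M ⊗ N)`. -/
def pushforwardTensor {X Y : Scheme.{u}} (f : X ⟶ Y) (M N : X.Modules) :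
    tensor ((Scheme.Modules.pushforward f).obj M) ((Scheme.Modules.pushforward f).obj N) ⟶
      (Scheme.Modules.pushforward f).obj (tensor M N) :=
  ((sheafifyAdj Y).homEquiv _ _).symm
    (presheafPushforwardTensor f M.val N.val ≫
      (presheafPushforward f).map ((sheafifyAdj X).unit.app (presheafTensor M.val N.val)))

/-- The canonical map `f^* (M ⊗ N) ⟶ f^* M ⊗ f^* N`, which corresponds by adjunction to
`M ⊗ N ⟶ f_* f^* M ⊗ f_* f^* N ⟶ f_* (f^* M ⊗ f^* N)`. -/
def pullbackTensor {X Y : Scheme.{u}} (f : X ⟶ Y) (M N : Y.Modules) :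
    (Scheme.Modules.pullback f).obj (tensor M N) ⟶
      tensor ((Scheme.Modules.pullback f).obj M) ((Scheme.Modules.pullback f).obj N) :=
  ((Scheme.Modules.pullbackPushforwardAdjunction f).homEquiv _ _).symm
    (tensorMap ((Scheme.Modules.pullbackPushforwardAdjunction f).unit.app M)
        ((Scheme.Modules.pullbackPushforwardAdjunction f).unit.app N) ≫
      pushforwardTensor f _ _)

/-- The canonical map `f^* 𝒪_Y ⟶ 𝒪_X`, which corresponds by adjunction to `𝒪_Y ⟶ f_* 𝒪_X`. -/
def pullbackUnit {X Y : Scheme.{u}} (f : X ⟶ Y) :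
    (Scheme.Modules.pullback f).obj (structureSheaf Y) ⟶ structureSheaf X :=
  ((Scheme.Modules.pullbackPushforwardAdjunction f).homEquiv _ _).symm
    (SheafOfModules.unitToPushforwardObjUnit f.toRingCatSheafHom)

/-- The tensor power `M^{⊗ m}` over `𝒪_X`. -/
def tensorPow {X : Scheme.{u}} (M : X.Modules) : ℕ → X.Modules
  | 0 => structureSheaf X
  | m + 1 => tensor (tensorPow M m) M

/-- The map `φ^{⊗ m} : f^* (M^{⊗ m}) ⟶ N^{⊗ m}` for `φ : f^* M ⟶ N`. It is `f^* 𝒪_Y ⟶ 𝒪_X`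
for `m = 0`, and `f^* (M^{⊗ m} ⊗ M) ⟶ f^* (M^{⊗ m}) ⊗ f^* M ⟶ N^{⊗ m} ⊗ N` for `m + 1`. -/
def tensorPowMap {X Y : Scheme.{u}} (f : X ⟶ Y) {M : Y.Modules} {N : X.Modules}
    (φ : (Scheme.Modules.pullback f).obj M ⟶ N) :
    (m : ℕ) → ((Scheme.Modules.pullback f).obj (tensorPow M m) ⟶ tensorPow N m)
  | 0 => pullbackUnit f
  | m + 1 => pullbackTensor f (tensorPow M m) M ≫ tensorMap (tensorPowMap f φ m) φ

/-! ### The sheaf of differentials and the differential of a morphism -/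

section Differentials

variable {K : Type u} [Field K]

/-- The ring homomorphisms `K → 𝒪_X(U)` of a `K`-scheme `X`. -/
def structureHom (X : Over (Spec (CommRingCat.of K))) :
    (Functor.const (Opens X.left)ᵒᵖ).obj (CommRingCat.of K) ⟶ X.left.presheaf where
  app U := (Scheme.ΓSpecIso (CommRingCat.of K)).inv ≫ Scheme.Hom.appTop X.hom ≫
    X.left.presheaf.map (homOfLE le_top : U.unop ⟶ ⊤).op
  naturality U V i := by
    simp only [Functor.const_obj_obj, Functor.const_obj_map, Category.id_comp, Category.assoc]
    rw [← Functor.map_comp]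
    rfl

/-- A morphism of `K`-schemes is compatible with the structure maps from `K`. -/
theorem structureHom_comp {X Y : Over (Spec (CommRingCat.of K))} (f : X ⟶ Y)
    (U : (Opens Y.left)ᵒᵖ) :
    (structureHom Y).app U ≫ f.left.c.app U =
      (structureHom X).app (.op (f.left ⁻¹ᵁ U.unop)) := by
  have hX : X.hom = f.left ≫ Y.hom := (Over.w f).symm
  dsimp only [structureHom]
  rw [Category.assoc, Category.assoc, hX, Scheme.Hom.comp_appTop, Category.assoc]
  congr 2
  exact f.left.c.naturality _

/-- The presheaf `U ↦ Ω_{𝒪_X(U)/K}` of Kähler differentials. -/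
def presheafDifferentials (X : Over (Spec (CommRingCat.of K))) : X.left.PresheafOfModules :=
  PresheafOfModules.DifferentialsConstruction.relativeDifferentials' (structureHom X)

/-- The sheaf of differentials `Ω_X = Ω_{X/K}`: the sheaf associated with `U ↦ Ω_{𝒪_X(U)/K}`. -/
def Omega (X : Over (Spec (CommRingCat.of K))) : X.left.Modules :=
  (sheafifyFunctor X.left).obj (presheafDifferentials X)

/-- The maps `Ω_{𝒪_Y(U)/K} → Ω_{𝒪_X(f⁻¹U)/K}`, `b db' ↦ f^♯(b) d(f^♯(b'))`. -/
def presheafDifferential {X Y : Over (Spec (CommRingCat.of K))} (f : X ⟶ Y) :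
    presheafDifferentials Y ⟶ (presheafPushforward f.left).obj (presheafDifferentials X) where
  app U := CommRingCat.KaehlerDifferential.map (f := (structureHom Y).app U)
    (f' := (structureHom X).app (.op (f.left ⁻¹ᵁ U.unop))) (g := 𝟙 _) (g' := f.left.c.app U)
    ((Category.id_comp _).trans (structureHom_comp f U).symm)
  naturality {U V} i := CommRingCat.KaehlerDifferential.ext fun b ↦ by
    have h₁ := CommRingCat.KaehlerDifferential.map_d
      ((Category.id_comp _).trans (structureHom_comp f V).symm) (Y.left.presheaf.map i b)
    have h₂ := CommRingCat.KaehlerDifferential.map_d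
      ((Category.id_comp _).trans (structureHom_comp f U).symm) b
    have h₃ := PresheafOfModules.DifferentialsConstruction.relativeDifferentials'_map_d
      (structureHom Y) i b
    have h₄ := PresheafOfModules.DifferentialsConstruction.relativeDifferentials'_map_d
      (structureHom X) ((Opens.map f.left.base).map i.unop).op (f.left.c.app U b)
    have h₅ : f.left.c.app V (Y.left.presheaf.map i b) =
        X.left.presheaf.map ((Opens.map f.left.base).map i.unop).op (f.left.c.app U b) :=
      congrArg (fun ψ ↦ ψ b) (f.left.c.naturality i)
    refine (congrArg _ h₃).trans (h₁.trans ?_)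
    refine Eq.trans ?_ ((congrArg _ h₂).trans h₄).symm
    exact congrArg _ h₅

/-- The differential `df : f^* Ω_Y ⟶ Ω_X`, which corresponds by adjunction to the map
`Ω_Y ⟶ f_* Ω_X` induced by `db ↦ d(f^♯(b))`. -/
def differential {X Y : Over (Spec (CommRingCat.of K))} (f : X ⟶ Y) :
    (Scheme.Modules.pullback f.left).obj (Omega Y) ⟶ Omega X :=
  ((Scheme.Modules.pullbackPushforwardAdjunction f.left).homEquiv _ _).symm
    (((sheafifyAdj Y.left).homEquiv _ ((Scheme.Modules.pushforward f.left).obj (Omega X))).symm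
      (presheafDifferential f ≫
        (presheafPushforward f.left).map ((sheafifyAdj X.left).unit.app _)))

end Differentials

/-! ### Cohomology of abelian sheaves and its pull-back -/

/-- Sheaves of abelian groups on a topological space. -/
abbrev AbSheaf (X : TopCat.{u}) := Sheaf (Opens.grothendieckTopology X) AddCommGrpCat.{u}

instance hasExtAbSheaf (X : TopCat.{u}) : HasExt.{u} (AbSheaf X) :=
  hasExt_of_enoughInjectives _

/-- The constant sheaf `ℤ_X`. Mathlib's sheaf cohomology is `H^p(X, F) = Ext^p(ℤ_X, F)`. -/
abbrev constZ (X : TopCat.{u}) : AbSheaf X :=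
  (constantSheaf (Opens.grothendieckTopology X) AddCommGrpCat.{u}).obj
    (AddCommGrpCat.of (ULift ℤ))

/-- The direct image `f_*` of abelian sheaves. -/
abbrev pushforwardAb {X Y : TopCat.{u}} (f : X ⟶ Y) : AbSheaf X ⥤ AbSheaf Y :=
  (Opens.map f).sheafPushforwardContinuous _ _ _

/-- The inverse image `f⁻¹` of abelian sheaves. -/
abbrev pullbackAb {X Y : TopCat.{u}} (f : X ⟶ Y) : AbSheaf Y ⥤ AbSheaf X :=
  (Opens.map f).sheafPullback _ _ _

abbrev adjAb {X Y : TopCat.{u}} (f : X ⟶ Y) : pullbackAb f ⊣ pushforwardAb f :=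
  (Opens.map f).sheafAdjunctionContinuous _ _ _

instance {X Y : TopCat.{u}} (f : X ⟶ Y) : Limits.PreservesFiniteLimits (pullbackAb f) :=
  Functor.SmallCategories.instPreservesFiniteLimitsSheafSheafPullbackOfRepresentablyFlat _ _ _ _

instance {X Y : TopCat.{u}} (f : X ⟶ Y) : Limits.PreservesFiniteColimits (pullbackAb f) :=
  have := (adjAb f).leftAdjoint_preservesColimits
  inferInstance

instance {X Y : TopCat.{u}} (f : X ⟶ Y) : (pullbackAb f).Additive :=
  Functor.additive_of_preserves_binary_products _

/-- The canonical map `ℤ_X ⟶ f⁻¹ ℤ_Y`, given by the image of `1` under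
`Γ(Y, ℤ_Y) → Γ(Y, f_* f⁻¹ ℤ_Y) = Γ(X, f⁻¹ ℤ_Y)`. -/
def constComparison {X Y : TopCat.{u}} (f : X ⟶ Y) : constZ X ⟶ (pullbackAb f).obj (constZ Y) :=
  ((constantSheafAdj (Opens.grothendieckTopology X) AddCommGrpCat.{u}
      Limits.isTerminalTop).homEquiv _ _).symm
    ((constantSheafAdj (Opens.grothendieckTopology Y) AddCommGrpCat.{u}
        Limits.isTerminalTop).unit.app _ ≫
      ((adjAb f).unit.app (constZ Y)).hom.app (.op ⊤))

/-- The canonical map `H^p(Y, f_* G) → H^p(X, G)`, i.e. the composite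
`H^p(Y, f_* G) → H^p(X, f⁻¹ f_* G) → H^p(X, G)` of the map induced by the exact functor `f⁻¹`
on `Ext^p(ℤ_Y, -)` and of the map induced by the counit `f⁻¹ f_* G ⟶ G`. -/
def pushH {X Y : TopCat.{u}} (f : X ⟶ Y) (G : AbSheaf X) (p : ℕ) :
    Sheaf.H ((pushforwardAb f).obj G) p →+ Sheaf.H G p :=
  ((Abelian.Ext.mk₀ ((adjAb f).counit.app G)).postcomp _ (add_zero p)).comp
    (((Abelian.Ext.mk₀ (constComparison f)).precomp _ (zero_add p)).comp
      ((pullbackAb f).mapExtAddHom _ _ p))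

theorem pushH_apply {X Y : TopCat.{u}} (f : X ⟶ Y) (G : AbSheaf X) (p : ℕ)
    (x : Sheaf.H ((pushforwardAb f).obj G) p) :
    pushH f G p x = ((Abelian.Ext.mk₀ (constComparison f)).comp
      (x.mapExactFunctor (pullbackAb f)) (zero_add p)).comp
        (Abelian.Ext.mk₀ ((adjAb f).counit.app G)) (add_zero p) := rfl

theorem pushH_natural {X Y : TopCat.{u}} (f : X ⟶ Y) {G G' : AbSheaf X} (α : G ⟶ G') (p : ℕ)
    (x : Sheaf.H ((pushforwardAb f).obj G) p) :
    pushH f G' p (Sheaf.H.map ((pushforwardAb f).map α) p x) =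
      Sheaf.H.map α p (pushH f G p x) := by
  have h : (pullbackAb f).map ((pushforwardAb f).map α) ≫ (adjAb f).counit.app G' =
    (adjAb f).counit.app G ≫ α := (adjAb f).counit.naturality α
  rw [pushH_apply, pushH_apply, Sheaf.H.map_apply, Sheaf.H.map_apply,
    Abelian.Ext.mapExactFunctor_comp, Abelian.Ext.mapExactFunctor_mk₀,
    ← Abelian.Ext.comp_assoc_of_third_deg_zero, Abelian.Ext.comp_assoc_of_third_deg_zero,
    Abelian.Ext.mk₀_comp_mk₀, h, ← Abelian.Ext.mk₀_comp_mk₀,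
    ← Abelian.Ext.comp_assoc_of_third_deg_zero]

/-- The endomorphisms of a sheaf act on its cohomology. -/
def endToEndH {X : TopCat.{u}} (F : AbSheaf X) (p : ℕ) :
    End F →+* AddMonoid.End (Sheaf.H F p) where
  toFun a := Sheaf.H.map a p
  map_one' := by ext x; exact Sheaf.H.map_id_apply x
  map_mul' a b := by ext x; exact Sheaf.H.map_comp_apply _ _ x
  map_zero' := by
    ext x
    exact (congrArg (fun y ↦ Abelian.Ext.comp x y (add_zero p)) (Abelian.Ext.mk₀_zero _ _)).trans
      (Abelian.Ext.comp_zero _ _ _ _ _)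
  map_add' a b := by ext x; exact Sheaf.H.map_add_apply _ _ x

/-! ### Cohomology of `𝒪_X`-modules on a `K`-scheme -/

section Cohomology

variable {K : Type u} [Field K]

/-- The sheaf of abelian groups underlying an `𝒪_X`-module. -/
abbrev abSheaf {X : Scheme.{u}} (M : X.Modules) : AbSheaf X :=
  (SheafOfModules.toSheaf X.ringCatSheaf).obj M

/-- The map of abelian sheaves underlying a map of `𝒪_X`-modules. -/
abbrev abSheafMap {X : Scheme.{u}} {M N : X.Modules} (φ : M ⟶ N) : abSheaf M ⟶ abSheaf N :=
  (SheafOfModules.toSheaf X.ringCatSheaf).map φ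

theorem scalar_ext {X : Scheme.{u}} {M : X.Modules} {a b : End (abSheaf M)}
    (h : ∀ U : (Opens X)ᵒᵖ, a.hom.app U = b.hom.app U) : a = b :=
  Sheaf.hom_ext (NatTrans.ext (funext h))

/-- Multiplication by the elements of `K` on an `𝒪_X`-module, `X` being a `K`-scheme. -/
def scalarEnd (X : Over (Spec (CommRingCat.of K))) (M : X.left.Modules) :
    K →+* End (abSheaf M) where
  toFun k := ⟨{ app := fun U => M.smul ((structureHom X).app U k)
                naturality := fun U V i => by
                  have h : X.left.presheaf.map i ((structureHom X).app U k) =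
                      (structureHom X).app V k :=
                    (congrArg (fun ψ ↦ ψ k) ((structureHom X).naturality i)).symm
                  have h' := Scheme.Modules.map_comp_smul (M := M) i.unop
                    ((structureHom X).app U k)
                  rw [← h]
                  exact h'.symm }⟩
  map_one' := scalar_ext fun U ↦
    (congrArg M.smul (map_one ((structureHom X).app U).hom)).trans (map_one M.smul)
  map_mul' k l := scalar_ext fun U ↦
    (congrArg M.smul (map_mul ((structureHom X).app U).hom k l)).trans (map_mul M.smul _ _)
  map_zero' := scalar_ext fun U ↦
    (congrArg M.smul (map_zero ((structureHom X).app U).hom)).trans (map_zero M.smul)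
  map_add' k l := scalar_ext fun U ↦
    (congrArg M.smul (map_add ((structureHom X).app U).hom k l)).trans (map_add M.smul _ _)

theorem scalarEnd_naturality (X : Over (Spec (CommRingCat.of K))) {M N : X.left.Modules}
    (φ : M ⟶ N) (k : K) :
    scalarEnd X M k ≫ abSheafMap φ = abSheafMap φ ≫ scalarEnd X N k := by
  apply Sheaf.hom_ext
  ext U x
  exact Scheme.Modules.Hom.app_smul φ _ x

theorem scalarEnd_pushforward {X Y : Over (Spec (CommRingCat.of K))} (f : X ⟶ Y)
    (M : X.left.Modules) (k : K) :
    scalarEnd Y ((Scheme.Modules.pushforward f.left).obj M) k =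
      (pushforwardAb f.left.base).map (scalarEnd X M k) :=
  scalar_ext fun U ↦
    congrArg M.smul (congrArg (fun ψ ↦ ψ k) (structureHom_comp f U))

/-- The cohomology group `H^p(X, M)` of an `𝒪_X`-module on a `K`-scheme `X`. -/
def Coh (X : Over (Spec (CommRingCat.of K))) (M : X.left.Modules) (p : ℕ) : Type u :=
  Sheaf.H (abSheaf M) p

instance (X : Over (Spec (CommRingCat.of K))) (M : X.left.Modules) (p : ℕ) :
    AddCommGroup (Coh X M p) :=
  inferInstanceAs (AddCommGroup (Sheaf.H (abSheaf M) p))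

/-- The `K`-vector space structure on `H^p(X, M)`: `k ∈ K` acts through multiplication by `k`
on `M`. -/
instance (X : Over (Spec (CommRingCat.of K))) (M : X.left.Modules) (p : ℕ) :
    Module K (Coh X M p) :=
  Module.compHom (Sheaf.H (abSheaf M) p) ((endToEndH (abSheaf M) p).comp (scalarEnd X M))

/-- The map `H^p(X, M) → H^p(X, N)` induced by `φ : M ⟶ N`. -/
def Coh.map {X : Over (Spec (CommRingCat.of K))} {M N : X.left.Modules} (φ : M ⟶ N) (p : ℕ) :
    Coh X M p →ₗ[K] Coh X N p where
  toFun := Sheaf.H.map (abSheafMap φ) p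
  map_add' := map_add _
  map_smul' k x := by
    have h (y : Sheaf.H (abSheaf M) p) :
        Sheaf.H.map (abSheafMap φ) p (Sheaf.H.map (scalarEnd X M k) p y) =
          Sheaf.H.map (scalarEnd X N k) p (Sheaf.H.map (abSheafMap φ) p y) :=
      (Sheaf.H.map_comp_apply _ _ y).symm.trans
        ((congrArg (fun ψ ↦ Sheaf.H.map ψ p y) (scalarEnd_naturality X φ k)).trans
          (Sheaf.H.map_comp_apply _ _ y))
    exact h x

/-- The canonical map `H^p(Y, f_* M) → H^p(X, M)`. -/
def Coh.ofPushforward {X Y : Over (Spec (CommRingCat.of K))} (f : X ⟶ Y) (M : X.left.Modules)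
    (p : ℕ) : Coh Y ((Scheme.Modules.pushforward f.left).obj M) p →ₗ[K] Coh X M p where
  toFun := pushH f.left.base (abSheaf M) p
  map_add' := map_add _
  map_smul' k x := by
    have h (ψ : (pushforwardAb f.left.base).obj (abSheaf M) ⟶
          (pushforwardAb f.left.base).obj (abSheaf M))
        (hψ : ψ = (pushforwardAb f.left.base).map (scalarEnd X M k))
        (y : Sheaf.H ((pushforwardAb f.left.base).obj (abSheaf M)) p) :
        pushH f.left.base (abSheaf M) p (Sheaf.H.map ψ p y) =
          Sheaf.H.map (scalarEnd X M k) p (pushH f.left.base (abSheaf M) p y) := by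
      subst hψ
      exact pushH_natural f.left.base _ p y
    exact h _ (scalarEnd_pushforward f M k) x

/-- The pull-back `H^p(Y, M) → H^p(Y, f_* f^* M) → H^p(X, f^* M)` on cohomology. -/
def Coh.pullback {X Y : Over (Spec (CommRingCat.of K))} (f : X ⟶ Y) (M : Y.left.Modules)
    (p : ℕ) : Coh Y M p →ₗ[K] Coh X ((Scheme.Modules.pullback f.left).obj M) p :=
  Coh.ofPushforward f _ p ∘ₗ
    Coh.map ((Scheme.Modules.pullbackPushforwardAdjunction f.left).unit.app M) p

/-- The map `H^p(Y, M) → H^p(X, f^* M) → H^p(X, N)` associated with `φ : f^* M ⟶ N`. -/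
def Coh.induced {X Y : Over (Spec (CommRingCat.of K))} (f : X ⟶ Y) {M : Y.left.Modules}
    {N : X.left.Modules} (φ : (Scheme.Modules.pullback f.left).obj M ⟶ N) (p : ℕ) :
    Coh Y M p →ₗ[K] Coh X N p :=
  Coh.map φ p ∘ₗ Coh.pullback f M p

/-- The map `D_m^p(f) : H^p(Y, Ω_Y^{⊗ m}) → H^p(X, Ω_X^{⊗ m})` associated with
`(df)^{⊗ m} : f^* Ω_Y^{⊗ m} ⟶ Ω_X^{⊗ m}`. -/
def D {X Y : Over (Spec (CommRingCat.of K))} (f : X ⟶ Y) (m p : ℕ) :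
    Coh Y (tensorPow (Omega Y) m) p →ₗ[K] Coh X (tensorPow (Omega X) m) p :=
  Coh.induced f (tensorPowMap f.left (differential f) m) p

end Cohomology

end SchemeForms

end

/-!
`D(f)` is the composite of `f^*` on cohomology with a map `f^* A ⟶ B` of sheaves. Passing to
adjuncts (`D_apply`), it becomes the composite
`H^p(Y, Ω_Y^{⊗ m}) → H^p(Y, f_* Ω_X^{⊗ m}) → H^p(X, Ω_X^{⊗ m})`
of a map induced by a map of sheaves with the canonical map `pushH`. No inverse image of modules
occurs any more, and functoriality in `f` splits into two independent parts.

The first is the functoriality of `pushH` (`pushH_comp`, `pushH_id`). The functors `(f ≫ g)⁻¹` and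
`f⁻¹ g⁻¹` are left adjoint to the same functor, hence isomorphic, compatibly with units, counits
and the comparison maps of constant sheaves. It remains to see that the action of exact functors on
`Ext` is natural in the functor and compatible with composition
(`mapExactFunctor_natTrans`, `mapExactFunctor_comp_functor`). Since there are enough injectives,
every `Ext` class is an iterated composite of extension classes of short exact sequences and one
morphism (`ext_induction`), and for these the claims are immediate.

The second is an identity of maps `Ω_Z^{⊗ m} ⟶ (f ≫ g)_* Ω_X^{⊗ m}` (`pushforwardPow_comp`,
`adjunct_differential_comp`). Both sides are given by maps out of a sheafification, so that it can
be checked on presheaves, where it holds on the generators `p ⊗ q` of tensor products and `db` of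
differentials (`presheafPushforwardTensor_comp`, `presheafDifferential_comp`). The functors
`g_* f_*` and `(f ≫ g)_*` agree by definition; the identification is nevertheless kept as an
explicit map `pushforwardComp`, and similarly for the identity.
-/

noncomputable section

namespace SchemeForms

/-! ### The action of exact functors on `Ext` groups -/

section Ext

universe w w' w'' v v' v'' u₁ u₂ u₃

open Abelian Limits

variable {C : Type u₁} [Category.{v} C] [Abelian C] [HasExt.{w} C] [EnoughInjectives C]
  {D : Type u₂} [Category.{v'} D] [Abelian D] [HasExt.{w'} D]
  {E : Type u₃} [Category.{v''} E] [Abelian E] [HasExt.{w''} E]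

/-- In a category with enough injectives, `Ext` classes are generated by morphisms under
composition with the classes of short exact sequences: embed `B` into an injective object, into
which there are no extensions of positive degree. -/
theorem ext_induction {A : C} {motive : ∀ (B : C) (n : ℕ), Ext A B n → Prop}
    (mk₀ : ∀ (B : C) (f : A ⟶ B), motive B 0 (Ext.mk₀ f))
    (comp_extClass : ∀ (S : ShortComplex C) (hS : S.ShortExact) (n : ℕ) (y : Ext A S.X₃ n),
      motive S.X₃ n y → motive S.X₁ (n + 1) (y.comp hS.extClass rfl))
    {B : C} {n : ℕ} (x : Ext A B n) : motive B n x := by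
  induction n generalizing B with
  | zero =>
    obtain ⟨f, rfl⟩ := (Ext.mk₀_bijective A B).2 x
    exact mk₀ B f
  | succ n hn =>
    let S := ShortComplex.mk _ _ (cokernel.condition (Injective.ι B))
    have hS : S.ShortExact :=
      { exact := ShortComplex.exact_of_g_is_cokernel _ (cokernelIsCokernel S.f) }
    obtain ⟨y, rfl⟩ := Ext.covariant_sequence_exact₁ A hS x (Ext.eq_zero_of_injective _) rfl
    exact comp_extClass S hS n y (hn y)

theorem mapExactFunctor_natTrans {F G : C ⥤ D} [F.Additive] [PreservesFiniteLimits F]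
    [PreservesFiniteColimits F] [G.Additive] [PreservesFiniteLimits G]
    [PreservesFiniteColimits G] (τ : F ⟶ G) {A B : C} {n : ℕ} (x : Ext A B n) :
    (x.mapExactFunctor F).comp (Ext.mk₀ (τ.app B)) (add_zero n) =
      (Ext.mk₀ (τ.app A)).comp (x.mapExactFunctor G) (zero_add n) := by
  induction x using ext_induction with
  | mk₀ B f =>
    rw [Ext.mapExactFunctor_mk₀, Ext.mapExactFunctor_mk₀, Ext.mk₀_comp_mk₀, Ext.mk₀_comp_mk₀,
      τ.naturality]
  | comp_extClass S hS n y hy =>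
    have h : (hS.extClass.mapExactFunctor F).comp (Ext.mk₀ (τ.app S.X₁)) (add_zero 1) =
        (Ext.mk₀ (τ.app S.X₃)).comp (hS.extClass.mapExactFunctor G) (zero_add 1) := by
      rw [Ext.mapExactFunctor_extClass, Ext.mapExactFunctor_extClass]
      exact ShortComplex.ShortExact.extClass_naturality (hS.map_of_exact F)
        (hS.map_of_exact G) (S.mapNatTrans τ)
    rw [Ext.mapExactFunctor_comp, Ext.mapExactFunctor_comp, Ext.comp_assoc_of_third_deg_zero, h,
      ← Ext.comp_assoc_of_second_deg_zero, hy]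
    exact Ext.comp_assoc _ _ _ (zero_add n) rfl (by omega)

theorem mapExactFunctor_comp_functor (F : C ⥤ D) [F.Additive] [PreservesFiniteLimits F]
    [PreservesFiniteColimits F] (G : D ⥤ E) [G.Additive] [PreservesFiniteLimits G]
    [PreservesFiniteColimits G] {A B : C} {n : ℕ} (x : Ext A B n) :
    x.mapExactFunctor (F ⋙ G) = (x.mapExactFunctor F).mapExactFunctor G := by
  induction x using ext_induction with
  | mk₀ B f =>
    rw [Ext.mapExactFunctor_mk₀, Ext.mapExactFunctor_mk₀, Ext.mapExactFunctor_mk₀]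
    rfl
  | comp_extClass S hS n y hy =>
    rw [Ext.mapExactFunctor_comp, Ext.mapExactFunctor_comp, Ext.mapExactFunctor_comp, hy,
      Ext.mapExactFunctor_extClass, Ext.mapExactFunctor_extClass]
    exact congrArg (fun e ↦ Ext.comp _ e rfl)
      (Ext.mapExactFunctor_extClass G (hS.map_of_exact F)).symm

theorem mapExactFunctor_id {A B : C} {n : ℕ} (x : Ext A B n) :
    x.mapExactFunctor (𝟭 C) = x := by
  induction x using ext_induction with
  | mk₀ B f =>
    rw [Ext.mapExactFunctor_mk₀]
    rfl
  | comp_extClass S hS n y hy =>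
    rw [Ext.mapExactFunctor_comp, hy, Ext.mapExactFunctor_extClass]
    rfl

/-- An exact functor `H` together with maps `a : A₂ ⟶ H A` and `e : H B ⟶ B₂` induces
`Ext A B n → Ext A₂ B₂ n`. If `H` maps to `F ⋙ G` compatibly with such maps for `F` and `G`, the
map induced by `H` is the composite of those induced by `F` and `G`. -/
theorem comp_mapExactFunctor_comp {H : C ⥤ E} [H.Additive] [PreservesFiniteLimits H]
    [PreservesFiniteColimits H] {F : C ⥤ D} [F.Additive] [PreservesFiniteLimits F]
    [PreservesFiniteColimits F] {G : D ⥤ E} [G.Additive] [PreservesFiniteLimits G]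
    [PreservesFiniteColimits G] (τ : H ⟶ F ⋙ G) {A B : C} {A₁ B₁ : D} {A₂ B₂ : E}
    {a : A₂ ⟶ H.obj A} {b : A₁ ⟶ F.obj A} {c : A₂ ⟶ G.obj A₁}
    (ha : a ≫ τ.app A = c ≫ G.map b) {e : H.obj B ⟶ B₂} {e₁ : F.obj B ⟶ B₁}
    {e₂ : G.obj B₁ ⟶ B₂} (he : τ.app B ≫ G.map e₁ ≫ e₂ = e) {n : ℕ} (x : Ext A B n) :
    ((Ext.mk₀ a).comp (x.mapExactFunctor H) (zero_add n)).comp (Ext.mk₀ e) (add_zero n) =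
      ((Ext.mk₀ c).comp ((((Ext.mk₀ b).comp (x.mapExactFunctor F) (zero_add n)).comp
        (Ext.mk₀ e₁) (add_zero n)).mapExactFunctor G) (zero_add n)).comp
          (Ext.mk₀ e₂) (add_zero n) := by
  have h := mapExactFunctor_natTrans τ x
  rw [mapExactFunctor_comp_functor] at h
  rw [← he, ← Ext.mk₀_comp_mk₀, ← Ext.comp_assoc_of_third_deg_zero,
    Ext.comp_assoc_of_third_deg_zero (Ext.mk₀ a), h, Ext.mapExactFunctor_comp,
    Ext.mapExactFunctor_comp, Ext.mapExactFunctor_mk₀, Ext.mapExactFunctor_mk₀,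
    Ext.mk₀_comp_mk₀_assoc, ha, ← Ext.mk₀_comp_mk₀_assoc, ← Ext.mk₀_comp_mk₀]
  simp only [Ext.comp_assoc_of_second_deg_zero, Ext.comp_assoc_of_third_deg_zero]

theorem comp_mapExactFunctor_id {F : C ⥤ C} [F.Additive] [PreservesFiniteLimits F]
    [PreservesFiniteColimits F] (τ : F ⟶ 𝟭 C) {A B : C} {a : A ⟶ F.obj A}
    (ha : a ≫ τ.app A = 𝟙 A) {e : F.obj B ⟶ B} (he : τ.app B = e) {n : ℕ} (x : Ext A B n) :
    ((Ext.mk₀ a).comp (x.mapExactFunctor F) (zero_add n)).comp (Ext.mk₀ e) (add_zero n) = x := by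
  have h := mapExactFunctor_natTrans τ x
  rw [mapExactFunctor_id] at h
  rw [← he, Ext.comp_assoc_of_third_deg_zero]
  refine (congrArg (fun y ↦ Ext.comp _ y (zero_add n)) h).trans ?_
  refine (Ext.mk₀_comp_mk₀_assoc _ _ _).trans ?_
  exact (congrArg (fun y ↦ (Ext.mk₀ y).comp x (zero_add n)) ha).trans (Ext.mk₀_id_comp x)

end Ext

/-! ### Functoriality of `H^p(Y, f_* G) → H^p(X, G)` -/

section AbelianSheaves

variable {X Y Z : TopCat.{u}} 

/-- The isomorphism `(f ≫ g)⁻¹ ≅ f⁻¹ g⁻¹` of inverse image functors, both being left adjoint to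
`(f ≫ g)_* = g_* f_*`. -/
def pullbackAbComp (f : X ⟶ Y) (g : Y ⟶ Z) :
    pullbackAb (f ≫ g) ≅ pullbackAb g ⋙ pullbackAb f :=
  (adjAb (f ≫ g)).leftAdjointUniq ((adjAb g).comp (adjAb f))

/-- The isomorphism of `(𝟙 X)⁻¹` with the identity, both being left adjoint to
`(𝟙 X)_*`, which is the identity by definition. -/
def pullbackAbId (X : TopCat.{u}) : pullbackAb (𝟙 X) ≅ 𝟭 (AbSheaf X) :=
  (adjAb (𝟙 X)).leftAdjointUniq Adjunction.id

theorem pullbackAbComp_unit (f : X ⟶ Y) (g : Y ⟶ Z) (F : AbSheaf Z) :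
    (adjAb (f ≫ g)).unit.app F ≫
        (pushforwardAb (f ≫ g)).map ((pullbackAbComp f g).hom.app F) =
      (adjAb g).unit.app F ≫
        (pushforwardAb g).map ((adjAb f).unit.app ((pullbackAb g).obj F)) :=
  (Adjunction.unit_leftAdjointUniq_hom_app (adjAb (f ≫ g)) ((adjAb g).comp (adjAb f)) F).trans
    (Adjunction.comp_unit_app _ _ _)

theorem pullbackAbComp_counit (f : X ⟶ Y) (g : Y ⟶ Z) (G : AbSheaf X) :
    (pullbackAbComp f g).hom.app ((pushforwardAb (f ≫ g)).obj G) ≫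
        (pullbackAb f).map ((adjAb g).counit.app ((pushforwardAb f).obj G)) ≫
          (adjAb f).counit.app G =
      (adjAb (f ≫ g)).counit.app G :=
  (congrArg (fun φ ↦ (pullbackAbComp f g).hom.app ((pushforwardAb (f ≫ g)).obj G) ≫ φ)
    (Adjunction.comp_counit_app (adjAb g) (adjAb f) G).symm).trans
  (Adjunction.leftAdjointUniq_hom_app_counit (adjAb (f ≫ g)) ((adjAb g).comp (adjAb f)) G)

theorem pullbackAbId_unit (F : AbSheaf X) :
    (adjAb (𝟙 X)).unit.app F ≫ (pushforwardAb (𝟙 X)).map ((pullbackAbId X).hom.app F) = 𝟙 F :=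
  Adjunction.unit_leftAdjointUniq_hom_app (adjAb (𝟙 X)) Adjunction.id F

theorem pullbackAbId_counit (F : AbSheaf X) :
    (pullbackAbId X).hom.app F = (adjAb (𝟙 X)).counit.app F :=
  (Category.comp_id _).symm.trans
    (Adjunction.leftAdjointUniq_hom_app_counit (adjAb (𝟙 X)) Adjunction.id F)

/-- The adjunction between the constant sheaf functor and the global sections functor. -/
abbrev constAdj (X : TopCat.{u}) :=
  constantSheafAdj (Opens.grothendieckTopology X) AddCommGrpCat.{u} Limits.isTerminalTop

theorem homEquiv_constComparison (f : X ⟶ Y) :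
    (constAdj X).homEquiv _ _ (constComparison f) =
      (constAdj Y).unit.app _ ≫ ((adjAb f).unit.app (constZ Y)).hom.app (.op ⊤) :=
  Equiv.apply_symm_apply _ _

theorem constComparison_comp (f : X ⟶ Y) (g : Y ⟶ Z) :
    constComparison (f ≫ g) ≫ (pullbackAbComp f g).hom.app (constZ Z) =
      constComparison f ≫ (pullbackAb f).map (constComparison g) := by
  apply ((constAdj X).homEquiv _ _).injective
  rw [Adjunction.homEquiv_naturality_right, Adjunction.homEquiv_naturality_right,
    homEquiv_constComparison, homEquiv_constComparison]
  have h₁ := congrArg (fun φ ↦ φ.hom.app (.op ⊤)) (pullbackAbComp_unit f g (constZ Z))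
  have h₂ := congrArg (fun φ ↦ φ.hom.app (.op ⊤)) ((adjAb f).unit.naturality (constComparison g))
  have h₃ := homEquiv_constComparison g
  rw [Adjunction.homEquiv_unit] at h₃
  refine ((Category.assoc _ _ _).trans
    (congrArg (fun φ ↦ (constAdj Z).unit.app _ ≫ φ) h₁)).trans ?_
  refine Eq.trans ?_ ((congrArg (fun φ ↦ (constAdj Y).unit.app _ ≫ φ) h₂).trans
    (Category.assoc _ _ _).symm)
  exact (Category.assoc _ _ _).symm.trans
    ((congrArg (fun φ ↦ φ ≫ ((adjAb f).unit.app ((pullbackAb g).obj (constZ Z))).hom.app (.op ⊤))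
      h₃.symm).trans (Category.assoc _ _ _))

theorem constComparison_id (X : TopCat.{u}) :
    constComparison (𝟙 X) ≫ (pullbackAbId X).hom.app (constZ X) = 𝟙 _ := by
  apply ((constAdj X).homEquiv _ _).injective
  rw [Adjunction.homEquiv_naturality_right, homEquiv_constComparison]
  have h := congrArg (fun φ ↦ φ.hom.app (.op ⊤)) (pullbackAbId_unit (constZ X))
  refine ((Category.assoc _ _ _).trans
    (congrArg (fun φ ↦ (constAdj X).unit.app _ ≫ φ) h)).trans ?_
  exact (Category.comp_id _).trans ((constAdj X).homEquiv_id _).symm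

theorem pushH_comp (f : X ⟶ Y) (g : Y ⟶ Z) (G : AbSheaf X) (p : ℕ)
    (x : Sheaf.H ((pushforwardAb (f ≫ g)).obj G) p) :
    pushH (f ≫ g) G p x = pushH f G p (pushH g ((pushforwardAb f).obj G) p x) := by
  have h := comp_mapExactFunctor_comp (H := pullbackAb (f ≫ g)) (F := pullbackAb g)
    (G := pullbackAb f) (pullbackAbComp f g).hom (b := constComparison g)
    (c := constComparison f) (constComparison_comp f g)
    (e₁ := (adjAb g).counit.app ((pushforwardAb f).obj G)) (e₂ := (adjAb f).counit.app G)
    (pullbackAbComp_counit f g G) x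
  refine (pushH_apply (f ≫ g) G p x).trans (Eq.trans ?_ (h.trans ?_))
  · rfl
  · rw [pushH_apply]
    rfl

theorem pushH_id (F : AbSheaf X) (p : ℕ) (x : Sheaf.H F p) :
    pushH (𝟙 X) F p x = x := by
  refine (pushH_apply (𝟙 X) F p x).trans ?_
  exact comp_mapExactFunctor_id (pullbackAbId X).hom (constComparison_id X)
    (pullbackAbId_counit F) x

end AbelianSheaves


/-! ### Commutative squares -/

section

variable {C : Type*} [Category* C]

/-- Two commutative squares with a common side paste to a commutative rectangle. -/
theorem paste_squares {A B A' B' A'' B'' : C} {u : A ⟶ B} {p : B ⟶ B'} {q : A ⟶ A'}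
    {v : A' ⟶ B'} {r : B' ⟶ B''} {s : A' ⟶ A''} {w : A'' ⟶ B''} (h₁ : u ≫ p = q ≫ v)
    (h₂ : v ≫ r = s ≫ w) : u ≫ (p ≫ r) = (q ≫ s) ≫ w := by
  rw [Category.assoc, ← h₂, ← Category.assoc, h₁, Category.assoc]

/-- A commutative square may be exchanged inside a composite of four maps. -/
theorem comp_comp_of_square {A B B₁ B₂ B' A' : C} {b : B ⟶ B₁} {c : B₁ ⟶ B'} {e : B ⟶ B₂}
    {k : B₂ ⟶ B'} (a : A ⟶ B) (h : b ≫ c = e ≫ k) (d : B' ⟶ A') :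
    (a ≫ b) ≫ (c ≫ d) = (a ≫ e) ≫ (k ≫ d) := by
  simp only [Category.assoc, reassoc_of% h]

theorem map_square {D : Type*} [Category* D] (F : C ⥤ D) {A B A' B' : C} {u : A ⟶ B} {p : B ⟶ B'}
    {q : A ⟶ A'} {v : A' ⟶ B'} (h : u ≫ p = q ≫ v) :
    F.map u ≫ F.map p = F.map q ≫ F.map v := by
  rw [← F.map_comp, h, F.map_comp]

end

/-! ### Tensor powers of maps `M ⟶ f_* N` -/

section

variable {X Y Z : Scheme.{u}}

/-- The adjunct `M ⟶ f_* N` of a map `f^* M ⟶ N`. -/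
def adjunct (f : X ⟶ Y) {M : Y.Modules} {N : X.Modules}
    (φ : (Scheme.Modules.pullback f).obj M ⟶ N) : M ⟶ (Scheme.Modules.pushforward f).obj N :=
  (Scheme.Modules.pullbackPushforwardAdjunction f).homEquiv _ _ φ

theorem adjunct_comp (f : X ⟶ Y) {M : Y.Modules} {N N' : X.Modules}
    (φ : (Scheme.Modules.pullback f).obj M ⟶ N) (ψ : N ⟶ N') :
    adjunct f (φ ≫ ψ) = adjunct f φ ≫ (Scheme.Modules.pushforward f).map ψ :=
  Adjunction.homEquiv_naturality_right _ _ _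

/-- Maps out of the associated sheaf of `P` are determined by their restrictions to `P`. -/
theorem sheafify_hom_ext {P : X.PresheafOfModules} {N : X.Modules}
    {a b : (sheafifyFunctor X).obj P ⟶ N}
    (h : (sheafifyAdj X).unit.app P ≫ a.val = (sheafifyAdj X).unit.app P ≫ b.val) : a = b :=
  ((sheafifyAdj X).homEquiv _ _).injective h

theorem unit_tensorMap {M N M' N' : X.Modules} (a : M ⟶ M') (b : N ⟶ N') :
    (sheafifyAdj X).unit.app (presheafTensor M.val N.val) ≫ (tensorMap a b).val =
      presheafTensorMap a.val b.val ≫ (sheafifyAdj X).unit.app (presheafTensor M'.val N'.val) :=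
  ((sheafifyAdj X).unit.naturality (presheafTensorMap a.val b.val)).symm

theorem unit_pushforwardTensor (f : X ⟶ Y) (M N : X.Modules) :
    (sheafifyAdj Y).unit.app (presheafTensor ((Scheme.Modules.pushforward f).obj M).val
        ((Scheme.Modules.pushforward f).obj N).val) ≫ (pushforwardTensor f M N).val =
      presheafPushforwardTensor f M.val N.val ≫
      (presheafPushforward f).map ((sheafifyAdj X).unit.app (presheafTensor M.val N.val)) :=
  ((sheafifyAdj Y).homEquiv _ _).apply_symm_apply _

theorem presheafTensor_hom_ext {P Q R : X.PresheafOfModules} {a b : presheafTensor P Q ⟶ R}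
    (h : ∀ (U : (Opens X)ᵒᵖ) (p : P.obj U) (q : Q.obj U),
      a.app U (TensorProduct.tmul (X.presheaf.obj U) p q) =
        b.app U (TensorProduct.tmul (X.presheaf.obj U) p q)) : a = b := by
  apply PresheafOfModules.hom_ext
  intro U
  exact ModuleCat.MonoidalCategory.tensor_ext (h U)

theorem presheafPushforwardTensor_natural (f : X ⟶ Y) {P Q P' Q' : X.PresheafOfModules}
    (a : P ⟶ P') (b : Q ⟶ Q') :
    presheafTensorMap ((presheafPushforward f).map a) ((presheafPushforward f).map b) ≫
        presheafPushforwardTensor f P' Q' =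
      presheafPushforwardTensor f P Q ≫ (presheafPushforward f).map (presheafTensorMap a b) :=
  presheafTensor_hom_ext fun _ _ _ ↦ rfl

/-- The identification `g_* f_* P = (f ≫ g)_* P` for presheaves, an identity map. -/
def presheafPushforwardComp (f : X ⟶ Y) (g : Y ⟶ Z) (P : X.PresheafOfModules) :
    (presheafPushforward g).obj ((presheafPushforward f).obj P) ⟶
      (presheafPushforward (f ≫ g)).obj P :=
  𝟙 _

theorem presheafPushforwardComp_natural (f : X ⟶ Y) (g : Y ⟶ Z) {P Q : X.PresheafOfModules}
    (a : P ⟶ Q) :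
    (presheafPushforward g).map ((presheafPushforward f).map a) ≫ presheafPushforwardComp f g Q =
      presheafPushforwardComp f g P ≫ (presheafPushforward (f ≫ g)).map a :=
  PresheafOfModules.hom_ext fun _ ↦ rfl

theorem presheafPushforwardTensor_comp (f : X ⟶ Y) (g : Y ⟶ Z) (P Q : X.PresheafOfModules) :
    presheafTensorMap (presheafPushforwardComp f g P) (presheafPushforwardComp f g Q) ≫
        presheafPushforwardTensor (f ≫ g) P Q =
      (presheafPushforwardTensor g ((presheafPushforward f).obj P)
          ((presheafPushforward f).obj Q) ≫
        (presheafPushforward g).map (presheafPushforwardTensor f P Q)) ≫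
          presheafPushforwardComp f g (presheafTensor P Q) :=
  presheafTensor_hom_ext fun _ _ _ ↦ rfl

/-- The identification `g_* f_* M = (f ≫ g)_* M`, the identity on sections. -/
def pushforwardComp (f : X ⟶ Y) (g : Y ⟶ Z) (M : X.Modules) :
    (Scheme.Modules.pushforward g).obj ((Scheme.Modules.pushforward f).obj M) ⟶
      (Scheme.Modules.pushforward (f ≫ g)).obj M :=
  (Scheme.Modules.pushforwardComp f g).hom.app M

theorem pushforwardTensor_natural (f : X ⟶ Y) {M N M' N' : X.Modules} (a : M ⟶ M')
    (b : N ⟶ N') :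
    tensorMap ((Scheme.Modules.pushforward f).map a) ((Scheme.Modules.pushforward f).map b) ≫
        pushforwardTensor f M' N' =
      pushforwardTensor f M N ≫ (Scheme.Modules.pushforward f).map (tensorMap a b) := by
  apply sheafify_hom_ext
  have h₁ := paste_squares (unit_tensorMap ((Scheme.Modules.pushforward f).map a)
    ((Scheme.Modules.pushforward f).map b)) (unit_pushforwardTensor f M' N')
  have h₂ := paste_squares (unit_pushforwardTensor f M N)
    (map_square (presheafPushforward f) (unit_tensorMap a b))
  exact h₁.trans ((congrArg (fun t ↦ t ≫ _)
    (presheafPushforwardTensor_natural f a.val b.val)).trans h₂.symm)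

theorem pushforwardTensor_comp (f : X ⟶ Y) (g : Y ⟶ Z) (M N : X.Modules) :
    tensorMap (pushforwardComp f g M) (pushforwardComp f g N) ≫ pushforwardTensor (f ≫ g) M N =
      (pushforwardTensor g ((Scheme.Modules.pushforward f).obj M)
          ((Scheme.Modules.pushforward f).obj N) ≫
        (Scheme.Modules.pushforward g).map (pushforwardTensor f M N)) ≫
          pushforwardComp f g (tensor M N) := by
  apply sheafify_hom_ext
  have h₁ := paste_squares (unit_tensorMap (pushforwardComp f g M) (pushforwardComp f g N))
    (unit_pushforwardTensor (f ≫ g) M N)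
  have h₂ := paste_squares (paste_squares
    (unit_pushforwardTensor g ((Scheme.Modules.pushforward f).obj M)
      ((Scheme.Modules.pushforward f).obj N))
    (map_square (presheafPushforward g) (unit_pushforwardTensor f M N)))
    (presheafPushforwardComp_natural f g ((sheafifyAdj X).unit.app (presheafTensor M.val N.val)))
  exact h₁.trans ((congrArg (fun t ↦ t ≫ _)
    (presheafPushforwardTensor_comp f g M.val N.val)).trans h₂.symm)

/-- The identity of `P`, as a map to the direct image of `P` under the identity of `X`. -/
def presheafToPushforwardId (P : X.PresheafOfModules) : P ⟶ (presheafPushforward (𝟙 X)).obj P :=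
  𝟙 P

/-- The identity of `M`, as a map to the direct image of `M` under the identity of `X`. -/
abbrev toPushforwardId (M : X.Modules) : M ⟶ (Scheme.Modules.pushforward (𝟙 X)).obj M :=
  (Scheme.Modules.pushforwardId X).inv.app M

theorem presheafPushforwardTensor_id (P Q : X.PresheafOfModules) :
    presheafTensorMap (presheafToPushforwardId P) (presheafToPushforwardId Q) ≫
      presheafPushforwardTensor (𝟙 X) P Q = presheafToPushforwardId (presheafTensor P Q) :=
  presheafTensor_hom_ext fun _ _ _ ↦ rfl

theorem presheafToPushforwardId_natural {P Q : X.PresheafOfModules} (a : P ⟶ Q) :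
    a ≫ presheafToPushforwardId Q =
      presheafToPushforwardId P ≫ (presheafPushforward (𝟙 X)).map a :=
  PresheafOfModules.hom_ext fun _ ↦ rfl

theorem pushforwardTensor_id (M N : X.Modules) :
    tensorMap (toPushforwardId M) (toPushforwardId N) ≫ pushforwardTensor (𝟙 X) M N =
      toPushforwardId (tensor M N) := by
  apply sheafify_hom_ext
  have h := paste_squares (unit_tensorMap (toPushforwardId M) (toPushforwardId N))
    (unit_pushforwardTensor (𝟙 X) M N)
  exact h.trans ((congrArg (fun t ↦ t ≫ _) (presheafPushforwardTensor_id M.val N.val)).trans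
    (presheafToPushforwardId_natural _).symm)

theorem tensorMap_comp {M N M' N' M'' N'' : X.Modules} (a : M ⟶ M') (b : N ⟶ N')
    (a' : M' ⟶ M'') (b' : N' ⟶ N'') :
    tensorMap (a ≫ a') (b ≫ b') = tensorMap a b ≫ tensorMap a' b' := by
  have h : presheafTensorMap (a.val ≫ a'.val) (b.val ≫ b'.val) =
      presheafTensorMap a.val b.val ≫ presheafTensorMap a'.val b'.val :=
    presheafTensor_hom_ext fun _ _ _ ↦ rfl
  exact (congrArg (sheafifyFunctor X).map h).trans ((sheafifyFunctor X).map_comp _ _)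

/-- The map `M^{⊗ m} ⟶ f_* (N^{⊗ m})` given by the powers of `s : M ⟶ f_* N`. -/
def pushforwardPow (f : X ⟶ Y) {M : Y.Modules} {N : X.Modules}
    (s : M ⟶ (Scheme.Modules.pushforward f).obj N) :
    (m : ℕ) → (tensorPow M m ⟶ (Scheme.Modules.pushforward f).obj (tensorPow N m))
  | 0 => SheafOfModules.unitToPushforwardObjUnit f.toRingCatSheafHom
  | m + 1 => tensorMap (pushforwardPow f s m) s ≫ pushforwardTensor f (tensorPow N m) N

/-- Under adjunction, `φ^{⊗ m} : f^* (M^{⊗ m}) ⟶ N^{⊗ m}` corresponds to the powers of the adjunct of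
`φ`. -/
theorem adjunct_tensorPowMap (f : X ⟶ Y) {M : Y.Modules} {N : X.Modules}
    (φ : (Scheme.Modules.pullback f).obj M ⟶ N) (m : ℕ) :
    adjunct f (tensorPowMap f φ m) = pushforwardPow f (adjunct f φ) m := by
  induction m with
  | zero => exact ((Scheme.Modules.pullbackPushforwardAdjunction f).homEquiv _ _).apply_symm_apply _
  | succ m ih =>
    have h (A : Y.Modules) (B : X.Modules) (ψ : (Scheme.Modules.pullback f).obj A ⟶ B) :
        adjunct f ψ = (Scheme.Modules.pullbackPushforwardAdjunction f).unit.app A ≫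
          (Scheme.Modules.pushforward f).map ψ := Adjunction.homEquiv_unit _ _ _ _
    have h' : adjunct f (pullbackTensor f (tensorPow M m) M) = _ :=
      ((Scheme.Modules.pullbackPushforwardAdjunction f).homEquiv _ _).apply_symm_apply _
    have h₁ : tensorMap (adjunct f (tensorPowMap f φ m)) (adjunct f φ) = _ :=
      (congrArg₂ tensorMap (h _ _ (tensorPowMap f φ m)) (h _ _ φ)).trans (tensorMap_comp _ _ _ _)
    rw [pushforwardPow, ← ih, h₁]
    refine (adjunct_comp f (pullbackTensor f (tensorPow M m) M)
      (tensorMap (tensorPowMap f φ m) φ)).trans ?_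
    rw [h']
    refine (Category.assoc _ _ _).trans (Eq.trans ?_ (Category.assoc _ _ _).symm)
    exact congrArg (fun t ↦ _ ≫ t) (pushforwardTensor_natural f _ _).symm

theorem pushforwardPow_comp (f : X ⟶ Y) (g : Y ⟶ Z) {L : Z.Modules} {M : Y.Modules}
    {N : X.Modules} (s : M ⟶ (Scheme.Modules.pushforward f).obj N)
    (t : L ⟶ (Scheme.Modules.pushforward g).obj M) (m : ℕ) :
    pushforwardPow (f ≫ g)
        ((t ≫ (Scheme.Modules.pushforward g).map s) ≫ pushforwardComp f g N) m =
      (pushforwardPow g t m ≫ (Scheme.Modules.pushforward g).map (pushforwardPow f s m)) ≫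
        pushforwardComp f g (tensorPow N m) := by
  induction m with
  | zero => rfl
  | succ m ih =>
    have h := comp_comp_of_square (tensorMap (pushforwardPow g t m) t)
      (pushforwardTensor_natural g (pushforwardPow f s m) s)
      ((Scheme.Modules.pushforward g).map (pushforwardTensor f (tensorPow N m) N))
    have h' : (Scheme.Modules.pushforward g).map (pushforwardPow f s (m + 1)) = _ :=
      (Scheme.Modules.pushforward g).map_comp (tensorMap (pushforwardPow f s m) s)
        (pushforwardTensor f (tensorPow N m) N)
    rw [h', pushforwardPow, pushforwardPow, ih, tensorMap_comp, tensorMap_comp]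
    refine (paste_squares rfl (pushforwardTensor_comp f g (tensorPow N m) N)).trans ?_
    exact congrArg (fun a ↦ a ≫ pushforwardComp f g _) h

theorem pushforwardPow_id (M : X.Modules) (m : ℕ) :
    pushforwardPow (𝟙 X) (toPushforwardId M) m = toPushforwardId (tensorPow M m) := by
  induction m with
  | zero => rfl
  | succ m ih =>
    exact (congrArg (fun s ↦ tensorMap s (toPushforwardId M) ≫ pushforwardTensor (𝟙 X) _ _)
      ih).trans (pushforwardTensor_id _ _)

end

/-! ### Differentials and cohomology -/

section

variable {K : Type u} [Field K] {X Y Z : Over (Spec (CommRingCat.of K))}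

theorem unit_adjunct_differential (f : X ⟶ Y) :
    (sheafifyAdj Y.left).unit.app (presheafDifferentials Y) ≫
      (adjunct f.left (differential f)).val =
      presheafDifferential f ≫
        (presheafPushforward f.left).map ((sheafifyAdj X.left).unit.app _) := by
  have h : adjunct f.left (differential f) = _ :=
    ((Scheme.Modules.pullbackPushforwardAdjunction f.left).homEquiv _ _).apply_symm_apply _
  rw [h]
  exact ((sheafifyAdj Y.left).homEquiv _ _).apply_symm_apply _

theorem presheafDifferential_comp (f : X ⟶ Y) (g : Y ⟶ Z) :
    presheafDifferential (f ≫ g) =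
      (presheafDifferential g ≫ (presheafPushforward g.left).map (presheafDifferential f)) ≫
        presheafPushforwardComp f.left g.left (presheafDifferentials X) := by
  apply PresheafOfModules.hom_ext
  intro U
  refine CommRingCat.KaehlerDifferential.ext fun b ↦ ?_
  -- Both sides send `db` to `d` of the pull-back of `b` along `f ≫ g`.
  have h₁ := CommRingCat.KaehlerDifferential.map_d
    ((Category.id_comp _).trans (structureHom_comp (f ≫ g) U).symm) b
  have h₂ := CommRingCat.KaehlerDifferential.map_d
    ((Category.id_comp _).trans (structureHom_comp g U).symm) b
  have h₃ := CommRingCat.KaehlerDifferential.map_d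
    ((Category.id_comp _).trans
      (structureHom_comp f (.op (g.left ⁻¹ᵁ U.unop))).symm) (g.left.c.app U b)
  exact h₁.trans (h₃.symm.trans (congrArg _ h₂.symm))

theorem presheafDifferential_id :
    presheafDifferential (𝟙 X) = presheafToPushforwardId (presheafDifferentials X) := by
  apply PresheafOfModules.hom_ext
  intro U
  exact CommRingCat.KaehlerDifferential.ext fun b ↦ CommRingCat.KaehlerDifferential.map_d
    ((Category.id_comp _).trans (structureHom_comp (𝟙 X) U).symm) b

theorem adjunct_differential_comp (f : X ⟶ Y) (g : Y ⟶ Z) :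
    adjunct (f ≫ g).left (differential (f ≫ g)) =
      (adjunct g.left (differential g) ≫
        (Scheme.Modules.pushforward g.left).map (adjunct f.left (differential f))) ≫
          pushforwardComp f.left g.left (Omega X) := by
  apply sheafify_hom_ext
  have h := paste_squares (paste_squares (unit_adjunct_differential g)
    (map_square (presheafPushforward g.left) (unit_adjunct_differential f)))
    (presheafPushforwardComp_natural f.left g.left
      ((sheafifyAdj X.left).unit.app (presheafDifferentials X)))
  exact (unit_adjunct_differential (f ≫ g)).trans ((congrArg (fun t ↦ t ≫ _)
    (presheafDifferential_comp f g)).trans h.symm)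

theorem adjunct_differential_id :
    adjunct (𝟙 X.left) (differential (𝟙 X)) = toPushforwardId (Omega X) := by
  apply sheafify_hom_ext
  exact (unit_adjunct_differential (𝟙 X)).trans ((congrArg (fun t ↦ t ≫ _)
    presheafDifferential_id).trans (presheafToPushforwardId_natural _).symm)

theorem ofPushforward_map (f : X ⟶ Y) {M N : X.left.Modules} (φ : M ⟶ N) (p : ℕ)
    (x : Coh Y ((Scheme.Modules.pushforward f.left).obj M) p) :
    Coh.ofPushforward f N p (Coh.map ((Scheme.Modules.pushforward f.left).map φ) p x) =
      Coh.map φ p (Coh.ofPushforward f M p x) :=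
  pushH_natural f.left.base (abSheafMap φ) p x

theorem Coh.map_comp {L M N : X.left.Modules} (φ : L ⟶ M) (ψ : M ⟶ N) (p : ℕ)
    (x : Coh X L p) : Coh.map (φ ≫ ψ) p x = Coh.map ψ p (Coh.map φ p x) :=
  Sheaf.H.map_comp_apply (abSheafMap φ) (abSheafMap ψ) x

theorem Coh.map_id (M : X.left.Modules) (p : ℕ) (x : Coh X M p) : Coh.map (𝟙 M) p x = x :=
  Sheaf.H.map_id_apply (F := abSheaf M) x

/-- The map on cohomology induced by `f^* M ⟶ N` factors through the map induced by its adjunct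
`M ⟶ f_* N`. -/
theorem Coh.induced_apply (f : X ⟶ Y) {M : Y.left.Modules}
    {N : X.left.Modules} (φ : (Scheme.Modules.pullback f.left).obj M ⟶ N) (p : ℕ)
    (x : Coh Y M p) :
    Coh.induced f φ p x = Coh.ofPushforward f N p (Coh.map (adjunct f.left φ) p x) := by
  have h : adjunct f.left φ = (Scheme.Modules.pullbackPushforwardAdjunction f.left).unit.app M ≫
      (Scheme.Modules.pushforward f.left).map φ := Adjunction.homEquiv_unit _ _ _ _
  rw [h, Coh.map_comp, ofPushforward_map]
  rfl

theorem D_apply (f : X ⟶ Y) (m p : ℕ) (x : Coh Y (tensorPow (Omega Y) m) p) :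
    D f m p x = Coh.ofPushforward f _ p
      (Coh.map (pushforwardPow f.left (adjunct f.left (differential f)) m) p x) := by
  rw [← adjunct_tensorPowMap]
  exact Coh.induced_apply f _ p x

theorem D_comp (f : X ⟶ Y) (g : Y ⟶ Z) (m p : ℕ) : D (f ≫ g) m p = D f m p ∘ₗ D g m p := by
  refine LinearMap.ext fun x ↦ ?_
  refine (D_apply (f ≫ g) m p x).trans ?_
  refine Eq.trans ?_ (D_apply f m p _).symm
  rw [D_apply g m p x]
  have h : pushforwardPow (f ≫ g).left (adjunct (f ≫ g).left (differential (f ≫ g))) m = _ :=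
    (congrArg (fun s ↦ pushforwardPow (f ≫ g).left s m) (adjunct_differential_comp f g)).trans
      (pushforwardPow_comp f.left g.left _ _ m)
  rw [← ofPushforward_map, ← Coh.map_comp, h]
  -- Composing with `pushforwardComp` does not change the underlying map of abelian sheaves, up to
  -- definitional unfolding.
  exact pushH_comp f.left.base g.left.base _ p _

theorem D_id (m p : ℕ) : D (𝟙 X) m p = LinearMap.id := by
  refine LinearMap.ext fun x ↦ ?_
  refine (D_apply (𝟙 X) m p x).trans ?_
  have h : pushforwardPow (𝟙 X.left) (adjunct (𝟙 X.left) (differential (𝟙 X))) m =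
      toPushforwardId (tensorPow (Omega X) m) :=
    (congrArg (fun s ↦ pushforwardPow (𝟙 X.left) s m)
      adjunct_differential_id).trans (pushforwardPow_id _ m)
  refine (pushH_id (X := X.left.carrier) (abSheaf (tensorPow (Omega X) m)) p _).trans ?_
  refine (congrArg (fun s ↦ Coh.map s p x) h).trans ?_
  exact Coh.map_id _ p x

end

end SchemeForms

end

theorem mainTheorem3 {K : Type u} [Field K]
    (X : CategoryTheory.Over (AlgebraicGeometry.Spec (CommRingCat.of K)))
    [AlgebraicGeometry.IsNoetherian X.left] (m p : ℕ) :
    (∀ f g : X ⟶ X,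
      SchemeForms.D (f ≫ g) m p = SchemeForms.D f m p ∘ₗ SchemeForms.D g m p) ∧
    ∀ (φ : CategoryTheory.End X) (n : ℕ),
      SchemeForms.D (X := X) (Y := X) (φ ^ n) m p =
        (SchemeForms.D (X := X) (Y := X) φ m p) ^ n := by
  refine ⟨fun f g ↦ SchemeForms.D_comp f g m p, fun φ n ↦ ?_⟩
  induction n with
  | zero => exact SchemeForms.D_id m p
  | succ n ih =>
    rw [pow_succ, pow_succ', ← ih]
    exact SchemeForms.D_comp φ (φ ^ n) m p
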